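/- Let $F$ be a nonarchimedean local field with ring of integers $\mathcal{O}$, uniformizer $\varpi$ and residue field $\mathcal{O}/\varpi\mathcal{O}$ of size $q$, and let $d\ge 2$. Let $G=PGL_d(F)$, let $K=PGL_d(\mathcal{O})\le G$ (the image of $GL_d(\mathcal{O})$ in $G$), and let $\mathcal{B}^0=G/K$ be the vertex set of the Bruhat–Tits building of $G$ (the coset $gK$ corresponds to the homothety class of the lattice $g\mathcal{O}^d\subset F^d$), with base vertex $\xi=K$. By the Cartan decomposition, every vertex $v\in\mathcal{B}^0$ lies in the $K$-orbit of $\mathrm{diag}(\varpi^{\alpha_1},\ldots,\varpi^{\alpha_{d-1}},1)\,\xi$ for a unique sequence of integers $\alpha_1\ge\cdots\ge\alpha_{d-1}\ge\alpha_d=0$; put $\Phi(v)=(\alpha_1-\alpha_2,\ldots,\alpha_{d-2}-\alpha_{d-1},\alpha_{d-1})\in\mathbb{N}^{d-1}$, where $\mathbb{N}=\{0,1,2,\ldots\}$. For $\vec{x}=(x_1,\ldots,x_{d-1})\in\mathbb{N}^{d-1}$ let $R(\vec{x})=\sum_{j=1}^{d-1}j(d-j)x_j$. Then for every $\vec{x}\in\mathbb{N}^{d-1}$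 the fiber $\Phi^{-1}(\vec{x})\subseteq\mathcal{B}^0$ is finite, and $$\left|\Phi^{-1}(\vec{x})\right|\;\le\;\left(\prod_{j=1}^{d-1}\frac{q^{j+1}-1}{q-1}\right)q^{R(\vec{x})}\;\le\; d!\,q^{\binom{d}{2}+R(\vec{x})}.$$ -/

import Mathlib

open scoped ValuativeRel MatrixGroups

namespace BTBuilding

noncomputable section

/-- The group `G = PGL_d(F)`. -/
abbrev G (F : Type*) [Field F] (d : ℕ) : Type _ :=
  Matrix.ProjGenLinGroup (Fin d) F

/-- The subgroup `K = PGL_d(𝒪)` of `PGL_d(F)`: the image of `GL_d(𝒪)` in `PGL_d(F)`, where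
`𝒪 = 𝒪[F]` is the ring of integers of `F`. -/
def K (F : Type*) [Field F] [ValuativeRel F] (d : ℕ) : Subgroup (G F d) :=
  (Matrix.GeneralLinearGroup.map (n := Fin d) (algebraMap 𝒪[F] F)).range.map
    Matrix.ProjGenLinGroup.mk

/-- The vertex set `ℬ⁰` of the Bruhat-Tits building of `PGL_d(F)`: the left cosets of `K` in `G`.
The coset `gK` stands for the homothety class of the lattice `g 𝒪^d` in `F^d`. The group `G` acts
by left multiplication. -/
abbrev Vertex (F : Type*) [Field F] [ValuativeRel F] (d : ℕ) : Type _ :=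
  G F d ⧸ K F d

/-- The base vertex `ξ`, whose stabilizer is `K`. -/
def baseVertex (F : Type*) [Field F] [ValuativeRel F] (d : ℕ) : Vertex F d :=
  ((1 : G F d) : Vertex F d)

/-- The exponents `α₁ ≥ ⋯ ≥ α_{d-1} ≥ α_d = 0` with `(α₁ - α₂, …, α_{d-2} - α_{d-1}, α_{d-1}) = x`,
that is, `α_i = x_i + x_{i+1} + ⋯ + x_{d-1}`. Indices are shifted by one: the coordinate `x_j`
(`1 ≤ j ≤ d - 1`) is `x ⟨j - 1, _⟩`, and `α_i` is `exponent x ⟨i - 1, _⟩`. -/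
def exponent {d : ℕ} (x : Fin (d - 1) → ℕ) (i : Fin d) : ℕ :=
  ∑ j ∈ Finset.univ.filter (fun j : Fin (d - 1) => (i : ℕ) ≤ (j : ℕ)), x j

/-- The diagonal matrix `ϖ^α = diag(ϖ^{α₁}, …, ϖ^{α_{d-1}}, 1)` with `α = exponent x`, in
`GL_d(F)`. -/
def diagMatrix {F : Type*} [Field F] [ValuativeRel F] {d : ℕ} {ϖ : 𝒪[F]} (hϖ : ϖ ≠ 0)
    (x : Fin (d - 1) → ℕ) : GL (Fin d) F :=
  Matrix.GeneralLinearGroup.mkOfDetNeZero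
    (Matrix.diagonal fun i => (ϖ : F) ^ exponent x i) (by
      rw [Matrix.det_diagonal, Finset.prod_ne_zero_iff]
      intro i _
      exact pow_ne_zero _ (fun h => hϖ (Subtype.ext h)))

/-- The vertex `ϖ^α ξ` of the sector `𝒮` that is identified with `x ∈ ℕ^{d-1}`. -/
def sectorVertex {F : Type*} [Field F] [ValuativeRel F] {d : ℕ} {ϖ : 𝒪[F]} (hϖ : ϖ ≠ 0)
    (x : Fin (d - 1) → ℕ) : Vertex F d :=
  (Matrix.ProjGenLinGroup.mk (diagMatrix hϖ x) : G F d) • baseVertex F d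

/-- The projection `Φ : ℬ⁰ → K \ ℬ⁰ ≅ 𝒮 ≅ ℕ^{d-1}`: `Φ v` is the `x` such that `v` lies in
the `K`-orbit of the sector vertex `ϖ^α ξ` identified with `x`. There is exactly one such `x` by the
Cartan decomposition (each `K`-orbit of vertices meets the sector exactly once). -/
def Phi {F : Type*} [Field F] [ValuativeRel F] {d : ℕ} {ϖ : 𝒪[F]} (hϖ : ϖ ≠ 0)
    (v : Vertex F d) : Fin (d - 1) → ℕ :=
  Classical.epsilon fun x => v ∈ MulAction.orbit (K F d) (sectorVertex hϖ x)

/-- The `R`-norm `R(x) = ∑_{j=1}^{d-1} j (d - j) x_j` on `ℕ^{d-1}` (with `x_j` written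
`x ⟨j - 1, _⟩`; the subtraction does not truncate). -/
def R {d : ℕ} (x : Fin (d - 1) → ℕ) : ℕ :=
  ∑ j : Fin (d - 1), ((j : ℕ) + 1) * (d - ((j : ℕ) + 1)) * x j

end

end BTBuilding

/-! A fiber of `Phi` lies in the `K`-orbit of its sector vertex (`Phi_preimage_subset`). Only
existence in the Cartan decomposition is needed, and it comes from Smith normal form over `𝒪[F]`. By
orbit–stabilizer, the orbit size is the index in GL_d(𝒪) of the vertex stabilizer, which contains
every g with g_ij ∈ 𝔪^(α_i - α_j) for i < j (`smul_sectorVertex_eq`).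

The index is bounded in `index_GL_mul_le` by counting modulo a high power of 𝔪. Strengthening each
exponent to α_i - α_j + 1 makes the reduction lower triangular, so invertibility only asks for unit
diagonal entries and the count is a product over entries. Comparing with |GL_d(𝓀)| = [d]_q! (q-1)^d
q^(d choose 2), all powers of q cancel except q^R, because R is the sum of α_i - α_j over i < j. The
last inequality bounds each geometric sum by its number of terms times its largest term. -/

namespace AddMonoidHom

lemma ncard_preimage_mul_card {A B : Type*} [AddGroup A] [AddGroup B] [Finite A] (f : A →+ B)
    (hf : Function.Surjective f) (S : Set B) :
    (f ⁻¹' S).ncard * Nat.card B = S.ncard * Nat.card A := by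
  classical
  have : Finite B := Finite.of_surjective f hf
  cases nonempty_fintype A
  cases nonempty_fintype B
  have key : ∀ S : Set B, (f ⁻¹' S).ncard = S.ncard * Nat.card f.ker := by
    intro S
    rw [← Nat.card_coe_set_eq, ← Nat.card_coe_set_eq, ← Nat.card_prod]
    refine Nat.card_congr (Equiv.trans (Equiv.sigmaFiberEquiv
      (fun a : f ⁻¹' S => (⟨f a, a.2⟩ : S))).symm ?_)
    refine (Equiv.sigmaCongrRight fun s => ?_).trans (Equiv.sigmaEquivProd _ _)
    let a := (hf s).choose
    have ha : f a = s := (hf s).choose_spec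
    refine ⟨fun x => ⟨-a + x.1.1, ?_⟩, fun y => ⟨⟨a + y.1, ?_⟩, ?_⟩, fun x => ?_, fun y => ?_⟩
    · have := congrArg Subtype.val x.2
      simp [AddMonoidHom.mem_ker, ha, ← this]
    · have := y.2
      rw [AddMonoidHom.mem_ker] at this
      simp [ha, this]
    · have := y.2
      rw [AddMonoidHom.mem_ker] at this
      ext; simp [ha, this]
    · ext; simp
    · ext; simp
  have h1 := key S
  have h2 := key Set.univ
  simp only [Set.preimage_univ, Set.ncard_univ] at h2
  rw [h1, h2]; ring
end AddMonoidHom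

/-! ### Counting matrices over quotients of a discrete valuation ring. -/

namespace IsLocalRing
lemma card_quotient_maximalIdeal_pow (A : Type*) [CommRing A] [IsDomain A]
    [IsDiscreteValuationRing A] (n : ℕ) :
    Nat.card (A ⧸ IsLocalRing.maximalIdeal A ^ n) = Nat.card (IsLocalRing.ResidueField A) ^ n := by
  have := cardQuot_pow_of_prime (P := IsLocalRing.maximalIdeal A)
    (IsDiscreteValuationRing.not_a_field A) (i := n)
  simpa [Submodule.cardQuot_apply, IsLocalRing.ResidueField] using this
end IsLocalRing

namespace IsLocalRing

/-- The reduction modulo `J i j` of the `(i, j)` entry of a matrix over `A ⧸ I`. -/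
def entryFactor {A : Type*} [CommRing A] {n : Type*} (I : Ideal A) (J : n → n → Ideal A)
    (h : ∀ i j, I ≤ J i j) : Matrix n n (A ⧸ I) →+ (∀ i j, A ⧸ J i j) where
  toFun M i j := Ideal.Quotient.factor (h i j) (M i j)
  map_zero' := by ext; simp
  map_add' _ _ := by ext; simp

lemma entryFactor_surjective {A : Type*} [CommRing A] {n : Type*} (I : Ideal A)
    (J : n → n → Ideal A) (h : ∀ i j, I ≤ J i j) :
    Function.Surjective (entryFactor I J h) := by
  intro N
  choose M hM using fun i j => Ideal.Quotient.factor_surjective (h i j) (N i j)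
  exact ⟨Matrix.of M, by ext i j; exact hM i j⟩

lemma ncard_range_val_units (M : Type*) [Monoid M] :
    (Set.range (Units.val : Mˣ → M)).ncard = Nat.card Mˣ := by
  rw [← Set.image_univ, Set.ncard_image_of_injective _ Units.val_injective, Set.ncard_univ]

lemma ncard_setPi {ι : Type*} [Fintype ι] {β : ι → Type*} (S : ∀ i, Set (β i)) :
    (Set.univ.pi S).ncard = ∏ i, (S i).ncard := by
  simp_rw [← Nat.card_coe_set_eq]
  rw [← Nat.card_pi]
  exact Nat.card_congr (Equiv.Set.univPi S)

variable {A : Type*} [CommRing A] [IsDomain A] [IsDiscreteValuationRing A]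

lemma finite_quotient_maximalIdeal_pow [Finite (ResidueField A)] (n : ℕ) :
    Finite (A ⧸ maximalIdeal A ^ n) :=
  Nat.finite_of_card_ne_zero (by
    rw [card_quotient_maximalIdeal_pow]; exact pow_ne_zero _ Nat.card_pos.ne')

/-- Invertible matrices reduce to invertible matrices over the residue field, and all fibers of the
reduction on matrices have the same size. -/
lemma card_GL_quotient_maximalIdeal_pow_le [Finite (ResidueField A)] (d : ℕ) {N : ℕ} (hN : N ≠ 0) :
    Nat.card (GL (Fin d) (A ⧸ maximalIdeal A ^ N)) * Nat.card (ResidueField A) ^ (d * d) ≤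
      Nat.card (GL (Fin d) (ResidueField A)) * Nat.card (ResidueField A) ^ (N * (d * d)) := by
  have := finite_quotient_maximalIdeal_pow (A := A) N
  have hI : maximalIdeal A ^ N ≤ maximalIdeal A := Ideal.pow_le_self hN
  let r : A ⧸ maximalIdeal A ^ N →+* ResidueField A := Ideal.Quotient.factor hI
  have hr : Function.Surjective r := Ideal.Quotient.factor_surjective hI
  let f : Matrix (Fin d) (Fin d) (A ⧸ maximalIdeal A ^ N) →+
    Matrix (Fin d) (Fin d) (ResidueField A) := r.mapMatrix.toAddMonoidHom
  have hf : Function.Surjective f := by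
    intro M
    choose g hg using hr
    exact ⟨M.map g, by ext i j; exact hg _⟩
  have h := f.ncard_preimage_mul_card hf (Set.range Units.val)
  have hsub : Set.range (Units.val : GL (Fin d) (A ⧸ maximalIdeal A ^ N) → _) ⊆
      f ⁻¹' Set.range Units.val := by
    rintro _ ⟨g, rfl⟩
    exact ⟨Matrix.GeneralLinearGroup.map r g, rfl⟩
  have hle := Set.ncard_le_ncard hsub
  rw [ncard_range_val_units] at hle h
  have c1 : Nat.card (Matrix (Fin d) (Fin d) (ResidueField A)) =
      Nat.card (ResidueField A) ^ (d * d) := by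
    simp [Matrix, Nat.card_fun, pow_mul]
  have c2 : Nat.card (Matrix (Fin d) (Fin d) (A ⧸ maximalIdeal A ^ N)) =
      Nat.card (ResidueField A) ^ (N * (d * d)) := by
    simp [Matrix, Nat.card_fun, card_quotient_maximalIdeal_pow, pow_mul]
  rw [c1, c2] at h
  rw [← h]
  exact Nat.mul_le_mul_right _ hle

/-- A matrix whose reduction is lower triangular with nonzero diagonal is invertible. -/
lemma isUnit_det_of_residue_lowerTriangular {d : ℕ} (M : Matrix (Fin d) (Fin d) A)
    (hu : ∀ i j, i < j → M i j ∈ maximalIdeal A) (hdiag : ∀ i, M i i ∉ maximalIdeal A) :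
    IsUnit M.det := by
  rw [← isUnit_map_iff (residue A), RingHom.map_det, Matrix.det_of_isLowerTriangular]
  · simp only [RingHom.mapMatrix_apply, Matrix.map_apply]
    rw [isUnit_iff_ne_zero, Finset.prod_ne_zero_iff]
    intro i _ h
    exact hdiag i ((residue_eq_zero_iff _).1 h)
  · intro i j hij
    exact (residue_eq_zero_iff _).2 (hu i j (by simpa using hij))

/-- The image of `H` modulo 𝔪^N contains an Iwahori-type set whose size is exact, which bounds its
index from above. The clause `H.index ≠ 0` records finiteness, since an infinite index is 0 by
convention. -/
theorem index_GL_mul_le [Finite (ResidueField A)] {d : ℕ} (a : Fin d → ℕ)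
    (H : Subgroup (GL (Fin d) A))
    (hH : ∀ g : GL (Fin d) A,
      (∀ i j, i < j → (g : Matrix _ _ A) i j ∈ maximalIdeal A ^ (a i - a j)) → g ∈ H) :
    H.index ≠ 0 ∧
    H.index * (Nat.card (ResidueField A) - 1) ^ d * Nat.card (ResidueField A) ^ (d * d) ≤
      Nat.card (GL (Fin d) (ResidueField A)) * Nat.card (ResidueField A) ^
        (d + ∑ i, ∑ j, if i < j then a i - a j + 1 else 0) := by
  classical
  set q := Nat.card (ResidueField A) with hq
  have hq0 : 0 < q := Nat.card_pos
  set N := ∑ i, a i + 1 with hN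
  have haN : ∀ i j, a i - a j + 1 ≤ N := fun i j => by
    have := Finset.single_le_sum (f := a) (fun _ _ => Nat.zero_le _) (Finset.mem_univ i)
    omega
  -- `N` exceeds every difference of exponents, so the congruence kernel modulo 𝔪^N lies in `H`.
  have := finite_quotient_maximalIdeal_pow (A := A) N
  let φ : GL (Fin d) A →* GL (Fin d) (A ⧸ maximalIdeal A ^ N) :=
    Matrix.GeneralLinearGroup.map (Ideal.Quotient.mk _)
  have hker : φ.ker ≤ H := by
    intro g hg
    refine hH g fun i j hij => ?_
    have h1 := congrArg (fun g : GL (Fin d) (A ⧸ maximalIdeal A ^ N) => g.1 i j)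
      (MonoidHom.mem_ker.1 hg)
    have h2 : Ideal.Quotient.mk (maximalIdeal A ^ N) ((g : Matrix _ _ A) i j) = 0 := by
      simpa [φ, Matrix.one_apply_ne hij.ne] using h1
    exact Ideal.pow_le_pow_right (by have := haN i j; omega) (Ideal.Quotient.eq_zero_iff_mem.1 h2)
  have hidx : H.index ∣ (H.map φ).index := by
    rw [Subgroup.index_map, sup_eq_left.2 hker]; exact dvd_mul_right _ _
  have hfin0 : (H.map φ).index ≠ 0 := Subgroup.index_ne_zero_of_finite
  have hcard := (H.map φ).card_mul_index
  -- Below the diagonal the exponent 0 gives a trivial quotient, so requiring the value 0 there is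
  -- no condition; on the diagonal, nonzero modulo 𝔪 means unit.
  let e : Fin d → Fin d → ℕ := fun i j => if i < j then a i - a j + 1 else if i = j then 1 else 0
  have he : ∀ i j, e i j ≤ N := fun i j => by
    have := haN i j
    simp only [e]; split_ifs <;> omega
  let J : Fin d → Fin d → Ideal A := fun i j => maximalIdeal A ^ e i j
  have hJ : ∀ i j, maximalIdeal A ^ N ≤ J i j := fun i j => Ideal.pow_le_pow_right (he i j)
  let S : ∀ i j, Set (A ⧸ J i j) := fun i j => if i = j then {0}ᶜ else {0}
  let T : Set (∀ i j, A ⧸ J i j) := Set.univ.pi fun i => Set.univ.pi fun j => S i j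
  have hpre := (entryFactor _ J hJ).ncard_preimage_mul_card (entryFactor_surjective _ J hJ) T
  have hTsub : entryFactor _ J hJ ⁻¹' T ⊆ Units.val '' (H.map φ : Set _) := by
    intro M hM
    choose g hg using Ideal.Quotient.mk_surjective (I := maximalIdeal A ^ N)
    have hMS : ∀ i j, Ideal.Quotient.mk (J i j) (g (M i j)) ∈ S i j := by
      intro i j
      have := hM i trivial j trivial
      change Ideal.Quotient.factor (hJ i j) (M i j) ∈ _ at this
      rwa [← hg (M i j), Ideal.Quotient.factor_mk] at this
    have hup : ∀ i j, i < j → g (M i j) ∈ maximalIdeal A ^ (a i - a j + 1) := by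
      intro i j hij
      have := hMS i j
      simp only [S, hij.ne, if_false, Set.mem_singleton_iff, Ideal.Quotient.eq_zero_iff_mem, J, e,
        hij, if_true] at this
      exact this
    have hdi : ∀ i, g (M i i) ∉ maximalIdeal A := by
      intro i
      have := hMS i i
      simp only [S, if_true, Set.mem_compl_iff, Set.mem_singleton_iff,
        Ideal.Quotient.eq_zero_iff_mem, J, e, lt_irrefl, if_false, pow_one] at this
      exact this
    have hdet := isUnit_det_of_residue_lowerTriangular (M.map g)
      (fun i j hij => Ideal.pow_le_self (by omega) (hup i j hij)) hdi
    let u : GL (Fin d) A := Matrix.GeneralLinearGroup.mk'' (M.map g) hdet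
    refine ⟨φ u, ⟨u, hH u fun i j hij => ?_, rfl⟩, ?_⟩
    · exact Ideal.pow_le_pow_right (Nat.le_succ _) (hup i j hij)
    · ext i j
      exact hg (M i j)
  have hTle : (entryFactor _ J hJ ⁻¹' T).ncard ≤ Nat.card (H.map φ) := by
    refine (Set.ncard_le_ncard hTsub).trans ?_
    rw [Set.ncard_image_of_injective _ Units.val_injective, ← Nat.card_coe_set_eq]
    rfl
  have hT : T.ncard = (q - 1) ^ d := by
    have hS : ∀ i j, (S i j).ncard = if i = j then q - 1 else 1 := by
      intro i j
      by_cases h : i = j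
      · subst h
        have : Finite (A ⧸ J i i) := finite_quotient_maximalIdeal_pow _
        simp only [S, if_true]
        rw [Set.ncard_compl, Set.ncard_singleton]
        simp only [J, e, hq, lt_irrefl, if_false, if_true, pow_one]
        rfl
      · simp [S, h]
    simp only [T, ncard_setPi, hS]
    simp
  have hB : Nat.card (∀ i j, A ⧸ J i j) =
      q ^ (d + ∑ i, ∑ j, if i < j then a i - a j + 1 else 0) := by
    simp_rw [Nat.card_pi, J, card_quotient_maximalIdeal_pow, Finset.prod_pow_eq_pow_sum, ← hq]
    congr 1
    have : ∀ i j, e i j = (if i = j then 1 else 0) + if i < j then a i - a j + 1 else 0 := by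
      intro i j
      simp only [e]
      split_ifs <;> omega
    simp_rw [this, Finset.sum_add_distrib]
    simp
  have hA : Nat.card (Matrix (Fin d) (Fin d) (A ⧸ maximalIdeal A ^ N)) = q ^ (N * (d * d)) := by
    simp [Matrix, Nat.card_fun, card_quotient_maximalIdeal_pow, pow_mul, hq]
  have hGL := card_GL_quotient_maximalIdeal_pow_le (A := A) d (N := N) (by omega)
  rw [hT, hB, hA] at hpre
  rw [← hq] at hGL
  refine ⟨fun h => hfin0 (by rw [h] at hidx; exact zero_dvd_iff.1 hidx), ?_⟩
  have hle := Nat.le_of_dvd (Nat.pos_of_ne_zero hfin0) hidx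
  have hpos : 0 < q ^ (N * (d * d)) := by positivity
  refine Nat.le_of_mul_le_mul_right ?_ hpos
  calc H.index * (q - 1) ^ d * q ^ (d * d) * q ^ (N * (d * d))
      = H.index * q ^ (d * d) * ((q - 1) ^ d * q ^ (N * (d * d))) := by ring
    _ = H.index * q ^ (d * d) * ((entryFactor _ J hJ ⁻¹' T).ncard *
        q ^ (d + ∑ i, ∑ j, if i < j then a i - a j + 1 else 0)) := by rw [hpre]
    _ ≤ (H.map φ).index * q ^ (d * d) * (Nat.card (H.map φ) *
        q ^ (d + ∑ i, ∑ j, if i < j then a i - a j + 1 else 0)) := by gcongr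
    _ = (Nat.card (H.map φ) * (H.map φ).index) * q ^ (d * d) *
        q ^ (d + ∑ i, ∑ j, if i < j then a i - a j + 1 else 0) := by ring
    _ ≤ (Nat.card (GL (Fin d) (ResidueField A)) * q ^ (N * (d * d))) *
        q ^ (d + ∑ i, ∑ j, if i < j then a i - a j + 1 else 0) := by
      rw [hcard]; gcongr
    _ = _ := by ring

end IsLocalRing

/-! ### Sums of exponents and q-factorial estimates. -/

namespace BTBuilding

lemma exponent_antitone {d : ℕ} (x : Fin (d - 1) → ℕ) : Antitone (exponent x) := by
  intro i j hij
  refine Finset.sum_le_sum_of_subset fun k hk => ?_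
  simp only [Finset.mem_filter, Finset.mem_univ, true_and] at hk ⊢
  exact le_trans hij hk

lemma exponent_sub_exponent {d : ℕ} (x : Fin (d - 1) → ℕ) {i j : Fin d} (hij : i ≤ j) :
    exponent x i - exponent x j =
      ∑ k : Fin (d - 1), if (i : ℕ) ≤ k ∧ (k : ℕ) < j then x k else 0 := by
  rw [Nat.sub_eq_iff_eq_add (exponent_antitone x hij)]
  simp only [exponent, Finset.sum_filter, ← Finset.sum_add_distrib]
  refine Finset.sum_congr rfl fun k _ => ?_
  have : (i : ℕ) ≤ j := hij
  split_ifs <;> omega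

/-- With 0-based indices, `x k` occurs once for each pair i ≤ k < j, hence (k + 1)(d - (k + 1))
times. -/
lemma sum_exponent_sub {d : ℕ} (x : Fin (d - 1) → ℕ) :
    (∑ i, ∑ j, if i < j then exponent x i - exponent x j else 0) = R x := by
  have h : ∀ i j : Fin d, (if i < j then exponent x i - exponent x j else 0) =
      ∑ k : Fin (d - 1), (if (i : ℕ) ≤ k then 1 else 0) * (if (k : ℕ) < j then 1 else 0) * x k := by
    intro i j
    split_ifs with hij
    · rw [exponent_sub_exponent x hij.le]
      refine Finset.sum_congr rfl fun k _ => ?_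
      split_ifs <;> omega
    · symm
      refine Finset.sum_eq_zero fun k _ => ?_
      have : ¬ (i : ℕ) < j := hij
      split_ifs <;> omega
  simp_rw [h]
  rw [R, Finset.sum_congr rfl fun i _ => Finset.sum_comm, Finset.sum_comm]
  refine Finset.sum_congr rfl fun k _ => ?_
  simp_rw [← Finset.sum_mul, ← Finset.mul_sum, ← Finset.sum_mul]
  have hk := k.2
  congr 2
  · rw [← Finset.card_filter]
    have : (Finset.univ.filter fun i : Fin d => (i : ℕ) ≤ k) = Finset.Iic ⟨k, by omega⟩ := by
      ext i; simp [Fin.le_def]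
    rw [this, Fin.card_Iic]
  · rw [← Finset.card_filter]
    have : (Finset.univ.filter fun i : Fin d => (k : ℕ) < i) = Finset.Ioi ⟨k, by omega⟩ := by
      ext i; simp [Fin.lt_def]
    rw [this, Fin.card_Ioi]
    simp; omega

lemma sum_ite_lt_one (d : ℕ) : (∑ i : Fin d, ∑ j, if i < j then 1 else 0) = d.choose 2 := by
  have h : ∀ i : Fin d, (∑ j, if i < j then 1 else 0) = d - 1 - i := by
    intro i
    rw [← Finset.card_filter]
    have : (Finset.univ.filter fun j => i < j) = Finset.Ioi i := by ext; simp
    rw [this, Fin.card_Ioi]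
  simp_rw [h]
  rw [Fin.sum_univ_eq_sum_range (fun i => d - 1 - i), Finset.sum_range_reflect (fun i => i),
    Finset.sum_range_id, Nat.choose_two_right]

lemma sum_exponent_sub_add_one {d : ℕ} (x : Fin (d - 1) → ℕ) :
    (∑ i, ∑ j, if i < j then exponent x i - exponent x j + 1 else 0) = R x + d.choose 2 := by
  rw [← sum_exponent_sub, ← sum_ite_lt_one]
  simp_rw [← Finset.sum_add_distrib]
  refine Finset.sum_congr rfl fun i _ => Finset.sum_congr rfl fun j _ => ?_
  split_ifs <;> rfl

lemma prod_pow_sub_pow {q : ℝ} (hq : 1 < q) (d : ℕ) :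
    ∏ i : Fin d, (q ^ d - q ^ (i : ℕ)) =
      (∏ j ∈ Finset.Icc 1 (d - 1), (q ^ (j + 1) - 1) / (q - 1)) * (q - 1) ^ d *
        q ^ d.choose 2 := by
  have h1 : ∏ i : Fin d, (q ^ d - q ^ (i : ℕ)) = ∏ i ∈ Finset.range d, (q ^ i * (q ^ (d - i) - 1)) := by
    rw [← Fin.prod_univ_eq_prod_range (fun i => q ^ i * (q ^ (d - i) - 1))]
    refine Finset.prod_congr rfl fun i _ => ?_
    rw [mul_sub, ← pow_add, Nat.add_sub_cancel' i.2.le, mul_one]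
  have h2 : ∏ i ∈ Finset.range d, (q ^ (d - i) - 1) = ∏ i ∈ Finset.range d, (q ^ (i + 1) - 1) := by
    rw [← Finset.prod_range_reflect]
    refine Finset.prod_congr rfl fun i hi => ?_
    have := Finset.mem_range.1 hi
    congr 2; omega
  have hq1 : q - 1 ≠ 0 := by linarith
  have h3 : ∏ i ∈ Finset.range d, (q ^ (i + 1) - 1) =
      (∏ i ∈ Finset.range d, (q ^ (i + 1) - 1) / (q - 1)) * (q - 1) ^ d := by
    rw [Finset.prod_div_distrib]; simp; field_simp
  have h4 : ∏ i ∈ Finset.range d, (q ^ (i + 1) - 1) / (q - 1) =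
      -- The extra factor, at index 0, equals 1.
      ∏ j ∈ Finset.Icc 1 (d - 1), (q ^ (j + 1) - 1) / (q - 1) := by
    symm
    refine Finset.prod_subset (fun i hi => ?_) fun i hi hi' => ?_
    · simp only [Finset.mem_Icc, Finset.mem_range] at *; omega
    · simp only [Finset.mem_Icc, Finset.mem_range] at *
      have : i = 0 := by omega
      subst this; simp [hq1]
  rw [h1, Finset.prod_mul_distrib, h2, h3, h4, Finset.prod_pow_eq_pow_sum, Finset.sum_range_id,
    Nat.choose_two_right]
  ring

lemma prod_geom_le_factorial_mul_pow {q : ℝ} (hq : 1 < q) (d : ℕ) :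
    ∏ j ∈ Finset.Icc 1 (d - 1), (q ^ (j + 1) - 1) / (q - 1) ≤ d.factorial * q ^ d.choose 2 := by
  have hg : ∀ j : ℕ, (q ^ (j + 1) - 1) / (q - 1) ≤ (j + 1 : ℕ) * q ^ j := by
    intro j
    rw [← geom_sum_eq hq.ne']
    calc ∑ i ∈ Finset.range (j + 1), q ^ i ≤ ∑ i ∈ Finset.range (j + 1), q ^ j :=
          Finset.sum_le_sum fun i hi =>
            pow_le_pow_right₀ hq.le (by have := Finset.mem_range.1 hi; omega)
      _ = _ := by simp
  have hg0 : ∀ j : ℕ, 0 ≤ (q ^ (j + 1) - 1) / (q - 1) := fun j =>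
    div_nonneg (by linarith [one_le_pow₀ hq.le (n := j + 1)]) (by linarith)
  refine (Finset.prod_le_prod (fun j _ => hg0 j) fun j _ => hg j).trans (le_of_eq ?_)
  have h4 : ∏ j ∈ Finset.Icc 1 (d - 1), ((j + 1 : ℕ) * q ^ j) =
      ∏ j ∈ Finset.range d, ((j + 1 : ℕ) * q ^ j) := by
    refine Finset.prod_subset (fun i hi => ?_) fun i hi hi' => ?_
    · simp only [Finset.mem_Icc, Finset.mem_range] at *; omega
    · simp only [Finset.mem_Icc, Finset.mem_range] at *
      have : i = 0 := by omega
      subst this; simp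
  rw [h4, Finset.prod_mul_distrib, Finset.prod_pow_eq_pow_sum, Finset.sum_range_id,
    Nat.choose_two_right, ← Nat.cast_prod, Finset.prod_range_add_one_eq_factorial]

end BTBuilding

/-! ### Smith normal form. -/

namespace Matrix

/-- Smith normal form of a square matrix with nonzero determinant over a principal ideal domain. -/
theorem exists_eq_mul_diagonal_mul {A n : Type*} [CommRing A] [IsDomain A]
    [IsPrincipalIdealRing A] [Fintype n] [DecidableEq n] (M : Matrix n n A) (hM : M.det ≠ 0) :
    ∃ (P Q : Matrix n n A) (a : n → A), IsUnit P ∧ IsUnit Q ∧ M = P * diagonal a * Q := by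
  have hinj : Function.Injective M.mulVecLin := by
    intro v w h
    exact mulVec_injective_of_det_ne_zero hM h
  let e := LinearEquiv.ofInjective M.mulVecLin hinj
  -- Adapted bases of A^n and of the column module satisfy c_i = a_i b_i; P and Q are the base
  -- changes to them from the standard basis and from the columns of M.
  obtain ⟨b, a, c, hc⟩ := Submodule.exists_smith_normal_form_of_rank_eq (Pi.basisFun A n)
    (N := LinearMap.range M.mulVecLin) e.finrank_eq.symm
  let b₀ := (Pi.basisFun A n).map e
  have := (Pi.basisFun A n).invertibleToMatrix b
  have := c.invertibleToMatrix b₀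
  refine ⟨(Pi.basisFun A n).toMatrix b, c.toMatrix b₀, a, isUnit_of_invertible _,
    isUnit_of_invertible _, ?_⟩
  ext i j
  have h1 := congrArg (fun z : LinearMap.range M.mulVecLin => (z : n → A) i)
    (c.sum_toMatrix_smul_self b₀ j)
  have h2 : (b₀ j : n → A) i = M i j := by
    simp [b₀, e]
  simp only [h2, AddSubmonoidClass.coe_finsetSum, Submodule.coe_smul, hc, Finset.sum_apply,
    Pi.smul_apply, smul_eq_mul] at h1
  rw [← h1, mul_apply]
  refine Finset.sum_congr rfl fun k _ => ?_
  simp only [mul_diagonal, Module.Basis.toMatrix_apply, Pi.basisFun_repr]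
  ring

theorem exists_eq_mul_diagonal_pow_mul {A : Type*} [CommRing A] [IsDomain A]
    [IsDiscreteValuationRing A] {ϖ : A} (hϖ : Irreducible ϖ) {d : ℕ}
    (M : Matrix (Fin d) (Fin d) A) (hM : M.det ≠ 0) :
    ∃ (P Q : GL (Fin d) A) (a : Fin d → ℕ), Antitone a ∧
      M = P.1 * diagonal (fun i => ϖ ^ a i) * Q.1 := by
  obtain ⟨P, Q, b, hP, hQ, rfl⟩ := M.exists_eq_mul_diagonal_mul hM
  have hb : ∀ i, b i ≠ 0 := by
    simp only [det_mul, det_diagonal] at hM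
    exact fun i => Finset.prod_ne_zero_iff.1 (right_ne_zero_of_mul (left_ne_zero_of_mul hM)) i
      (Finset.mem_univ i)
  choose n u hu using fun i => IsDiscreteValuationRing.eq_unit_mul_pow_irreducible (hb i) hϖ
  -- Sorting in the dual order makes the exponents decreasing; the permutation is absorbed into both
  -- outer factors and the units into the right one.
  let σ := Tuple.sort (fun i => OrderDual.toDual (n i))
  have hσ : Antitone (n ∘ σ) := Tuple.monotone_sort (fun i => OrderDual.toDual (n i))
  have hU : IsUnit (diagonal fun i => (u i : A)) := by
    rw [isUnit_iff_isUnit_det, det_diagonal]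
    exact IsUnit.prod_univ_iff.2 fun i => (u i).isUnit
  have hP' : IsUnit (P.submatrix id σ) :=
    (isUnit_submatrix_equiv (Equiv.refl _) σ).2 hP
  have hQ' : IsUnit (((diagonal fun i => (u i : A)) * Q).submatrix σ id) :=
    (isUnit_submatrix_equiv σ (Equiv.refl _)).2 (hU.mul hQ)
  refine ⟨hP'.unit, hQ'.unit, n ∘ σ, hσ, ?_⟩
  ext i j
  simp only [IsUnit.unit_spec, mul_apply (M := _ * diagonal _), mul_diagonal, submatrix_apply, id,
    diagonal_mul, Function.comp]
  rw [Equiv.sum_comp σ fun k => P i k * ϖ ^ n k * (u k * Q k j)]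
  refine Finset.sum_congr rfl fun k _ => ?_
  rw [hu]; ring

end Matrix

namespace BTBuilding

lemma sum_Ico_sub_succ_of_antitone {f : ℕ → ℕ} (hf : Antitone f) {i m : ℕ} (him : i ≤ m) :
    ∑ k ∈ Finset.Ico i m, (f k - f (k + 1)) = f i - f m := by
  induction m, him using Nat.le_induction with
  | base => simp
  | succ m hm ih =>
    rw [Finset.sum_Ico_succ_top hm, ih]
    have := hf hm
    have := hf (Nat.le_succ m)
    simp only [Nat.succ_eq_add_one] at *
    omega

/-- Here m is the last exponent; it contributes a scalar, which is trivial in PGL_d. -/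
lemma exists_exponent_add {d : ℕ} (a : Fin d → ℕ) (ha : Antitone a) :
    ∃ (x : Fin (d - 1) → ℕ) (m : ℕ), ∀ i, a i = exponent x i + m := by
  rcases Nat.eq_zero_or_pos d with rfl | hd
  · exact ⟨fun _ => 0, 0, fun i => i.elim0⟩
  let f : ℕ → ℕ := fun k => a ⟨min k (d - 1), by omega⟩
  have hf : Antitone f := fun k l hkl => ha (by
    rw [Fin.mk_le_mk]; exact min_le_min_right _ hkl)
  refine ⟨fun k => f k - f (k + 1), f (d - 1), fun i => ?_⟩
  have h : exponent (fun k : Fin (d - 1) => f k - f (k + 1)) i =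
      ∑ k ∈ Finset.Ico (i : ℕ) (d - 1), (f k - f (k + 1)) := by
    rw [exponent, Finset.sum_filter,
      Fin.sum_univ_eq_sum_range (fun k => if (i : ℕ) ≤ k then f k - f (k + 1) else 0),
      ← Finset.sum_filter]
    refine Finset.sum_congr ?_ fun _ _ => rfl
    ext k; simp [and_comm]
  have hi : (i : ℕ) ≤ d - 1 := by omega
  rw [h, sum_Ico_sub_succ_of_antitone hf hi, Nat.sub_add_cancel (hf hi)]
  simp only [f]
  congr 1
  ext; simp [hi]

end BTBuilding

/-! ### Orbits of `K` and stabilizers of sector vertices. -/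

namespace BTBuilding

section Orbit

variable (F : Type*) [Field F] [ValuativeRel F] (d : ℕ)

/-- The canonical map `GL_d(𝒪) → PGL_d(F)`, whose range is `K`. -/
noncomputable def integralToPGL : GL (Fin d) 𝒪[F] →* G F d :=
  Matrix.ProjGenLinGroup.mk.comp (Matrix.GeneralLinearGroup.map (algebraMap 𝒪[F] F))

lemma range_integralToPGL : (integralToPGL F d).range = K F d := by
  rw [integralToPGL, MonoidHom.range_comp, K]

lemma integralToPGL_mem_K (g : GL (Fin d) 𝒪[F]) : integralToPGL F d g ∈ K F d := by
  rw [← range_integralToPGL]; exact ⟨g, rfl⟩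

variable {F d}

lemma index_stabilizer_comap (v : Vertex F d) :
    ((MulAction.stabilizer (G F d) v).comap (integralToPGL F d)).index =
      (MulAction.orbit (K F d) v).ncard := by
  let ψ : GL (Fin d) 𝒪[F] →* K F d :=
    (integralToPGL F d).codRestrict (K F d) (integralToPGL_mem_K F d)
  have hψ : Function.Surjective ψ := by
    rintro ⟨k, hk⟩
    rw [← range_integralToPGL] at hk
    obtain ⟨g, rfl⟩ := hk
    exact ⟨g, rfl⟩
  rw [← MulAction.index_stabilizer, ← Subgroup.index_comap_of_surjective _ hψ]
  congr 1

/-- The divisibility conditions say exactly that conjugating g by ϖ^α leaves it integral. The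
conjugate has the same determinant, so it lies in GL_d(𝒪) and fixes the base vertex. -/
lemma smul_sectorVertex_eq [IsDiscreteValuationRing 𝒪[F]]
    {ϖ : 𝒪[F]} (hϖ : Irreducible ϖ) (x : Fin (d - 1) → ℕ) (g : GL (Fin d) 𝒪[F])
    (hg : ∀ i j, i < j →
      (g : Matrix _ _ 𝒪[F]) i j ∈ IsLocalRing.maximalIdeal 𝒪[F] ^ (exponent x i - exponent x j)) :
    integralToPGL F d g • sectorVertex hϖ.ne_zero x = sectorVertex hϖ.ne_zero x := by
  have h1 : ∀ i j, ∃ c, g.1 i j * ϖ ^ exponent x j = ϖ ^ exponent x i * c := by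
    intro i j
    rcases lt_or_ge i j with hij | hij
    · have := hg i j hij
      rw [hϖ.maximalIdeal_eq, Ideal.span_singleton_pow, Ideal.mem_span_singleton] at this
      obtain ⟨c, hc⟩ := this
      refine ⟨c, ?_⟩
      rw [hc, mul_right_comm, ← pow_add, Nat.sub_add_cancel (exponent_antitone x hij.le)]
    · refine ⟨ϖ ^ (exponent x j - exponent x i) * g.1 i j, ?_⟩
      rw [← mul_assoc, ← pow_add, Nat.add_sub_cancel' (exponent_antitone x hij), mul_comm]
  choose c hc using h1
  have hmul : g.1 * Matrix.diagonal (fun i => ϖ ^ exponent x i) =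
      Matrix.diagonal (fun i => ϖ ^ exponent x i) * Matrix.of c := by
    ext i j
    simp [Matrix.mul_diagonal, Matrix.diagonal_mul, hc]
  have hdet : IsUnit (Matrix.of c).det := by
    have h := congrArg Matrix.det hmul
    rw [Matrix.det_mul, Matrix.det_mul, mul_comm] at h
    rw [← mul_left_cancel₀ ?_ h]
    · exact (Matrix.isUnit_iff_isUnit_det _).1 g.isUnit
    · rw [Matrix.det_diagonal]
      exact Finset.prod_ne_zero_iff.2 fun i _ => pow_ne_zero _ hϖ.ne_zero
  let g' : GL (Fin d) 𝒪[F] := Matrix.GeneralLinearGroup.mk'' (Matrix.of c) hdet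
  have hGL : Matrix.GeneralLinearGroup.map (algebraMap 𝒪[F] F) g * diagMatrix hϖ.ne_zero x =
      diagMatrix hϖ.ne_zero x * Matrix.GeneralLinearGroup.map (algebraMap 𝒪[F] F) g' := by
    have h := congrArg (Matrix.map · (algebraMap 𝒪[F] F)) hmul
    simp only [Matrix.map_mul] at h
    rw [Matrix.diagonal_map (map_zero _)] at h
    apply Units.ext
    exact h
  have hP := congrArg Matrix.ProjGenLinGroup.mk hGL
  rw [map_mul, map_mul] at hP
  rw [sectorVertex, smul_smul]
  change (integralToPGL F d g * _ = _ * integralToPGL F d g') at hP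
  rw [hP, mul_smul]
  congr 1
  change (((integralToPGL F d g' * 1 : G F d)) : Vertex F d) = ((1 : G F d) : Vertex F d)
  rw [QuotientGroup.eq]
  simpa using (K F d).inv_mem (integralToPGL_mem_K F d g')

/-- Existence in the Cartan decomposition. -/
lemma exists_mem_orbit_sectorVertex [IsDiscreteValuationRing 𝒪[F]]
    [IsFractionRing 𝒪[F] F]
    {ϖ : 𝒪[F]} (hϖ : Irreducible ϖ) (v : Vertex F d) :
    ∃ x, v ∈ MulAction.orbit (K F d) (sectorVertex hϖ.ne_zero x) := by
  obtain ⟨p, rfl⟩ := QuotientGroup.mk_surjective v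
  obtain ⟨g, rfl⟩ := Matrix.ProjGenLinGroup.mk_surjective p
  -- Clearing denominators changes g by a scalar, so its class in PGL_d is unchanged.
  obtain ⟨b, hb⟩ := IsLocalization.exist_integer_multiples_of_finite (nonZeroDivisors 𝒪[F])
    (fun ij : Fin d × Fin d => g.1 ij.1 ij.2)
  choose M hM using hb
  let N : Matrix (Fin d) (Fin d) 𝒪[F] := Matrix.of fun i j => M (i, j)
  have hb0 : algebraMap 𝒪[F] F b ≠ 0 :=
    IsFractionRing.to_map_ne_zero_of_mem_nonZeroDivisors b.2
  have hN : N.map (algebraMap 𝒪[F] F) = algebraMap 𝒪[F] F b • g.1 := by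
    ext i j
    have := hM (i, j)
    rw [Algebra.smul_def] at this
    exact this
  have hdetN : N.det ≠ 0 := by
    intro h
    have h' := congrArg (algebraMap 𝒪[F] F) h
    rw [RingHom.map_det, map_zero, RingHom.mapMatrix_apply, hN, Matrix.det_smul] at h'
    exact mul_ne_zero (pow_ne_zero _ hb0) ((Matrix.isUnit_iff_isUnit_det _).1 g.isUnit).ne_zero h'
  obtain ⟨P, Q, a, ha, hPQ⟩ := Matrix.exists_eq_mul_diagonal_pow_mul hϖ N hdetN
  obtain ⟨x, m, hx⟩ := exists_exponent_add a ha
  have hϖF : algebraMap 𝒪[F] F ϖ ≠ 0 := by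
    simpa using hϖ.ne_zero
  let u : Fˣ := Units.mk0 _ hb0
  let w : Fˣ := Units.mk0 _ (pow_ne_zero m hϖF)
  let f := Matrix.GeneralLinearGroup.map (n := Fin d) (algebraMap 𝒪[F] F)
  have hg : Matrix.GeneralLinearGroup.scalar (Fin d) u * g =
      f P * diagMatrix hϖ.ne_zero x * f Q * Matrix.GeneralLinearGroup.scalar (Fin d) w := by
    have h := congrArg (Matrix.map · (algebraMap 𝒪[F] F)) hPQ
    simp only [Matrix.map_mul] at h
    rw [hN, Matrix.diagonal_map (map_zero _)] at h
    apply Units.ext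
    change Matrix.scalar (Fin d) (algebraMap 𝒪[F] F b) * g.1 =
      P.1.map (algebraMap 𝒪[F] F) * Matrix.diagonal (fun i => algebraMap 𝒪[F] F ϖ ^ exponent x i) *
      Q.1.map (algebraMap 𝒪[F] F) * Matrix.scalar (Fin d) (algebraMap 𝒪[F] F ϖ ^ m)
    have hD : (Matrix.diagonal fun i => algebraMap 𝒪[F] F (ϖ ^ a i)) =
        algebraMap 𝒪[F] F ϖ ^ m • Matrix.diagonal fun i => algebraMap 𝒪[F] F ϖ ^ exponent x i := by
      rw [← Matrix.diagonal_smul]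
      congr 1
      ext i
      simp [hx, pow_add, mul_comm]
    rw [Matrix.scalar_apply, ← Matrix.smul_eq_diagonal_mul, h, hD, Matrix.mul_smul,
      Matrix.smul_mul]
    ext i j
    rw [Matrix.scalar_apply, Matrix.mul_diagonal]
    exact mul_comm _ _
  have hmk := congrArg Matrix.ProjGenLinGroup.mk hg
  simp only [map_mul, Matrix.ProjGenLinGroup.mk_scalar, one_mul, mul_one] at hmk
  refine ⟨x, ⟨integralToPGL F d P, integralToPGL_mem_K F d P⟩, ?_⟩
  rw [hmk]
  change (((integralToPGL F d P * (Matrix.ProjGenLinGroup.mk (diagMatrix hϖ.ne_zero x) * 1) : G F d))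
    : Vertex F d) = _
  rw [QuotientGroup.eq]
  have : (integralToPGL F d P * (Matrix.ProjGenLinGroup.mk (diagMatrix hϖ.ne_zero x) * 1))⁻¹ *
      (Matrix.ProjGenLinGroup.mk (f P) * Matrix.ProjGenLinGroup.mk (diagMatrix hϖ.ne_zero x) *
        Matrix.ProjGenLinGroup.mk (f Q)) = integralToPGL F d Q := by
    change ((integralToPGL F d P) * (_ * 1))⁻¹ * (integralToPGL F d P * _ * integralToPGL F d Q) = _
    group
  rw [this]
  exact integralToPGL_mem_K F d Q

lemma Phi_preimage_subset [IsDiscreteValuationRing 𝒪[F]]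
    [IsFractionRing 𝒪[F] F] {ϖ : 𝒪[F]} (hϖ : Irreducible ϖ) (x : Fin (d - 1) → ℕ) :
    Phi (d := d) hϖ.ne_zero ⁻¹' {x} ⊆ MulAction.orbit (K F d) (sectorVertex hϖ.ne_zero x) := by
  rintro v rfl
  -- Whichever x the choice picks, it satisfies the orbit condition; uniqueness plays no role.
  exact Classical.epsilon_spec (exists_mem_orbit_sectorVertex hϖ v)

end Orbit

/-- The `K`-orbit of a sector vertex is finite, of size at most `[d]_q! q^{R(x)}`. -/
theorem ncard_orbit_sectorVertex_le {F : Type*} [Field F] [ValuativeRel F]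
    [IsDiscreteValuationRing 𝒪[F]] [Finite 𝓀[F]]
    {ϖ : 𝒪[F]} (hϖ : Irreducible ϖ) {d : ℕ} (x : Fin (d - 1) → ℕ) :
    (MulAction.orbit (K F d) (sectorVertex (d := d) hϖ.ne_zero x)).ncard ≠ 0 ∧
    ((MulAction.orbit (K F d) (sectorVertex (d := d) hϖ.ne_zero x)).ncard : ℝ) ≤
      (∏ j ∈ Finset.Icc 1 (d - 1), ((Nat.card 𝓀[F] : ℝ) ^ (j + 1) - 1) / ((Nat.card 𝓀[F] : ℝ) - 1)) *
        (Nat.card 𝓀[F] : ℝ) ^ R x := by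
  have hidx := IsLocalRing.index_GL_mul_le (exponent x)
    ((MulAction.stabilizer (G F d) (sectorVertex hϖ.ne_zero x)).comap (integralToPGL F d))
    (fun g hg => smul_sectorVertex_eq hϖ x g hg)
  rw [index_stabilizer_comap, sum_exponent_sub_add_one] at hidx
  refine ⟨hidx.1, ?_⟩
  have h := hidx.2
  cases nonempty_fintype 𝓀[F]
  have hq1 : 1 < Nat.card 𝓀[F] := Finite.one_lt_card
  change _ ≤ Nat.card (GL (Fin d) 𝓀[F]) * _ at h
  rw [Matrix.card_GL_field, ← Nat.card_eq_fintype_card] at h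
  change _ * (Nat.card 𝓀[F] - 1) ^ d * Nat.card 𝓀[F] ^ _ ≤ _ * Nat.card 𝓀[F] ^ _ at h
  generalize Nat.card 𝓀[F] = q at *
  generalize (MulAction.orbit (K F d) (sectorVertex (d := d) hϖ.ne_zero x)).ncard = n at *
  have h' : (n : ℝ) * ((q : ℝ) - 1) ^ d * (q : ℝ) ^ (d * d) ≤
      (∏ i : Fin d, ((q : ℝ) ^ d - (q : ℝ) ^ (i : ℕ))) * (q : ℝ) ^ (d + (R x + d.choose 2)) := by
    have hc : ((∏ i : Fin d, (q ^ d - q ^ (i : ℕ)) : ℕ) : ℝ) =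
        ∏ i : Fin d, ((q : ℝ) ^ d - (q : ℝ) ^ (i : ℕ)) := by
      rw [Nat.cast_prod]
      refine Finset.prod_congr rfl fun i _ => ?_
      rw [Nat.cast_sub (Nat.pow_le_pow_right (by omega) i.2.le)]
      push_cast; rfl
    have h2 : ((n * (q - 1) ^ d * q ^ (d * d) : ℕ) : ℝ) ≤ _ := Nat.cast_le.2 h
    rw [Nat.cast_mul (∏ i : Fin d, (q ^ d - q ^ (i : ℕ))), hc] at h2
    push_cast [Nat.cast_sub hq1.le] at h2
    exact h2
  have hq1' : (1 : ℝ) < q := by exact_mod_cast hq1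
  rw [prod_pow_sub_pow hq1'] at h'
  -- One binomial comes from |GL_d(𝓀)|, the other from the +1 in the exponents; together with d they
  -- cancel q^(d²).
  have hdd : d + 2 * d.choose 2 = d * d := by
    rw [Nat.choose_two_right, Nat.mul_div_cancel' (Nat.even_mul_pred_self d).two_dvd]
    rcases d with _ | d
    · rfl
    · simp; ring
  have hpos : 0 < ((q : ℝ) - 1) ^ d * (q : ℝ) ^ (d * d) := by
    have : (0 : ℝ) < q - 1 := by linarith
    positivity
  refine le_of_mul_le_mul_right ?_ hpos
  calc (n : ℝ) * (((q : ℝ) - 1) ^ d * (q : ℝ) ^ (d * d)) ≤ _ := (mul_assoc _ _ _).ge.trans h'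
    _ = _ := by rw [← hdd]; ring

end BTBuilding

/-- Upper bounds for the size of the fibers of the projection `Φ : ℬ⁰ → ℕ^{d-1}` of the vertices
of the Bruhat-Tits building of `PGL_d(F)`; `q` is the size of the residue field. -/
theorem corollary4p4 {F : Type*} [Field F] [ValuativeRel F] [TopologicalSpace F]
    [IsNonarchimedeanLocalField F] (ϖ : 𝒪[F]) (hϖ : Irreducible ϖ)
    (q : ℕ) (hq : q = Nat.card 𝓀[F]) (d : ℕ) (hd : 2 ≤ d) (x : Fin (d - 1) → ℕ) :
    (BTBuilding.Phi (d := d) hϖ.ne_zero ⁻¹' {x}).Finite ∧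
    ((BTBuilding.Phi (d := d) hϖ.ne_zero ⁻¹' {x}).ncard : ℝ) ≤
      (∏ j ∈ Finset.Icc 1 (d - 1), ((q : ℝ) ^ (j + 1) - 1) / ((q : ℝ) - 1)) *
        (q : ℝ) ^ BTBuilding.R x ∧
    (∏ j ∈ Finset.Icc 1 (d - 1), ((q : ℝ) ^ (j + 1) - 1) / ((q : ℝ) - 1)) *
        (q : ℝ) ^ BTBuilding.R x ≤
      (Nat.factorial d : ℝ) * (q : ℝ) ^ (Nat.choose d 2 + BTBuilding.R x) := by
  have hfrac : IsFractionRing 𝒪[F] F := inferInstance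
  have hsub := BTBuilding.Phi_preimage_subset (d := d) hϖ x
  obtain ⟨h0, hle⟩ := BTBuilding.ncard_orbit_sectorVertex_le (d := d) hϖ x
  have hfin := Set.finite_of_ncard_ne_zero h0
  have hq1 : (1 : ℝ) < q := by
    have : 1 < Nat.card 𝓀[F] := Finite.one_lt_card
    rw [hq]; exact_mod_cast this
  rw [← hq] at hle
  refine ⟨hfin.subset hsub, le_trans ?_ hle, ?_⟩
  · exact_mod_cast Set.ncard_le_ncard hsub hfin
  · rw [pow_add, ← mul_assoc]
    exact mul_le_mul_of_nonneg_right (BTBuilding.prod_geom_le_factorial_mul_pow hq1 d)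
      (by positivity)
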